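/- \textbf{Setting.} Let $d\in\mathbb N$, let $\Omega,\Sigma\subset\mathbb R^d$ be bounded open sets with $\Sigma=-\Sigma$ (for instance, $\Omega$ a bounded Lipschitz domain and $\Sigma$ an open ball or cube centred at the origin), and put $\Omega_\Sigma=\{x\in\mathbb R^d : \exists\, y\in\Sigma,\ x-y\in\Omega\}$. Let $1<q\le 2$ and $s\in[q,\infty)$, and write $r'=r/(r-1)$. All spaces are real. $\mathcal M(\Omega_\Sigma)$ is the space of finite signed Radon measures on $\Omega_\Sigma$ with the total variation norm, and a tilde denotes extension by zero to $\mathbb R^d$. For $c\in\mathcal M(\Omega_\Sigma)$ and $p\in L^s(\Sigma)$ let $K(c,p)\in L^q(\Omega)$ be the function determined by $$\int_\Omega K(c,p)\,h\,\mathrm dx=\int_{\Omega_\Sigma}\int_{\mathbb R^d}\tilde h(z+y)\,\tilde p(z)\,\mathrm dz\,\mathrm dc(y)\qquad\text{for all } h\in L^{q'}(\Omega),$$ that is, the convolution $x\mapsto\int \tilde p(x-y)\,\mathrm dc(y)$. Then $K$ is a bounded bilinear map. Let $X_s=\mathcal M(\Omega_\Sigma)\otimes_\pi L^s(\Sigma)$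 be the completed projective tensor product and $\hat K:X_s\to L^q(\Omega)$ the bounded linear map with $\hat K(c\otimes p)=K(c,p)$. Let $C_0(\Omega_\Sigma)\otimes_{\mathfrak i}L^{s'}(\Sigma)$ be the completed injective tensor product. The weak* topology on $X_s$ is the one given by the identification $X_s\cong (C_0(\Omega_\Sigma)\otimes_{\mathfrak i}L^{s'}(\Sigma))^*$ through the pairing $\langle c\otimes p,f\otimes g\rangle=\int f\,\mathrm dc\,\int_\Sigma p\,g\,\mathrm dx$, that is, the coarsest topology making $u\mapsto\langle u,\psi\rangle$ continuous for every $\psi\in C_0(\Omega_\Sigma)\otimes_{\mathfrak i}L^{s'}(\Sigma)$. Let $J:C_0(\Omega_\Sigma)\otimes_{\mathfrak i}L^{s'}(\Sigma)\to C_0(\Omega_\Sigma,L^{s'}(\Sigma))$ be the canonical isometry with $J(f\otimes g)(t)=f(t)\,g$. \textbf{Lemma.} (i) $\hat K:X_s\to L^q(\Omega)$ is continuous from the weak* topology of $X_s$ to the weak topology of $L^q(\Omega)$. (ii) For every $\phi\in C_0(\Omega)\subset L^{q'}(\Omega)$ the functional $\hat K^*\phi\in X_s^*$, $u\mapsto\int_\Omega(\hat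 Ku)\,\phi\,\mathrm dx$, belongs to $C_0(\Omega_\Sigma)\otimes_{\mathfrak i}L^{s'}(\Sigma)$: there is $\psi\in C_0(\Omega_\Sigma)\otimes_{\mathfrak i}L^{s'}(\Sigma)$ with $\langle u,\psi\rangle=\int_\Omega(\hat Ku)\,\phi\,\mathrm dx$ for all $u\in X_s$. Under the identification $J$ it is given by $J\psi(t)=[x\mapsto\tilde\phi(t+x)]\in L^{s'}(\Sigma)$ for every $t\in\Omega_\Sigma$. -/

import Mathlib

set_option maxSynthPendingDepth 3

open MeasureTheory Set Filter Topology
open scoped ENNReal TensorProduct ZeroAtInfty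

noncomputable section

/-! ### Projective and injective tensor products of normed spaces -/

section Tensor

variable (X Y Z : Type*) [NormedAddCommGroup X] [NormedSpace ℝ X]
  [NormedAddCommGroup Y] [NormedSpace ℝ Y] [NormedAddCommGroup Z] [NormedSpace ℝ Z]

variable {X Y} in
/-- The values `∑ ‖xᵢ‖ ‖yᵢ‖` over all finite representations `u = ∑ xᵢ ⊗ yᵢ`. -/
def projValues (u : X ⊗[ℝ] Y) : Set ℝ :=
  {r | ∃ (n : ℕ) (x : Fin n → X) (y : Fin n → Y),
    u = ∑ i, x i ⊗ₜ[ℝ] y i ∧ r = ∑ i, ‖x i‖ * ‖y i‖}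

variable {X Y} in
/-- The projective tensor norm on the algebraic tensor product. -/
def projNorm (u : X ⊗[ℝ] Y) : ℝ := sInf (projValues u)

variable {X Y Z} in
theorem projValues_nonempty (u : X ⊗[ℝ] Y) : (projValues u).Nonempty := by
  induction u using TensorProduct.induction_on with
  | zero => exact ⟨0, 0, Fin.elim0, Fin.elim0, by simp, by simp⟩
  | tmul x y => exact ⟨_, 1, fun _ => x, fun _ => y, by simp, rfl⟩
  | add u v hu hv =>
    obtain ⟨_, n, x, y, hu, rfl⟩ := hu
    obtain ⟨_, m, x', y', hv, rfl⟩ := hv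
    refine ⟨_, n + m, Fin.append x x', Fin.append y y', ?_, rfl⟩
    rw [Fin.sum_univ_add]
    simp [hu, hv]

variable {X Y Z} in
theorem projValues_nonneg {u : X ⊗[ℝ] Y} {r : ℝ} (hr : r ∈ projValues u) : 0 ≤ r := by
  obtain ⟨n, x, y, -, rfl⟩ := hr
  positivity

variable {X Y Z} in
theorem projValues_bddBelow (u : X ⊗[ℝ] Y) : BddBelow (projValues u) :=
  ⟨0, fun _ hr => projValues_nonneg hr⟩

variable {X Y Z} in
theorem projNorm_add_le (u v : X ⊗[ℝ] Y) : projNorm (u + v) ≤ projNorm u + projNorm v := by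
  refine le_of_forall_pos_le_add fun ε hε => ?_
  obtain ⟨_, ⟨n, x, y, hu, rfl⟩, hu'⟩ :=
    Real.lt_sInf_add_pos (projValues_nonempty u) (half_pos hε)
  obtain ⟨_, ⟨m, x', y', hv, rfl⟩, hv'⟩ :=
    Real.lt_sInf_add_pos (projValues_nonempty v) (half_pos hε)
  have : projNorm (u + v) ≤ (∑ i, ‖x i‖ * ‖y i‖) + ∑ i, ‖x' i‖ * ‖y' i‖ := by
    refine csInf_le (projValues_bddBelow _)
      ⟨n + m, Fin.append x x', Fin.append y y', ?_, ?_⟩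
    · rw [Fin.sum_univ_add]
      simp [hu, hv]
    · rw [Fin.sum_univ_add]
      simp
  unfold projNorm at *
  linarith

variable {X Y Z} in
theorem projNorm_smul_le (a : ℝ) (u : X ⊗[ℝ] Y) : projNorm (a • u) ≤ ‖a‖ * projNorm u := by
  refine le_of_forall_pos_le_add fun ε hε => ?_
  obtain ⟨_, ⟨n, x, y, hu, rfl⟩, hu'⟩ :=
    Real.lt_sInf_add_pos (projValues_nonempty u) (ε := ε / (‖a‖ + 1)) (by positivity)
  have h1 : projNorm (a • u) ≤ ‖a‖ * ∑ i, ‖x i‖ * ‖y i‖ := by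
    refine csInf_le (projValues_bddBelow _) ⟨n, fun i => a • x i, y, ?_, ?_⟩
    · rw [hu, Finset.smul_sum]
      simp [TensorProduct.smul_tmul']
    · simp [norm_smul, Finset.mul_sum, mul_assoc]
  have h2 : ‖a‖ * (ε / (‖a‖ + 1)) ≤ ε := by
    rw [mul_div_assoc', div_le_iff₀ (by positivity)]
    nlinarith [norm_nonneg a]
  have h3 : ‖a‖ * ∑ i, ‖x i‖ * ‖y i‖ ≤ ‖a‖ * (projNorm u + ε / (‖a‖ + 1)) :=
    mul_le_mul_of_nonneg_left hu'.le (norm_nonneg a)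
  linarith

variable {X Y} in
/-- The projective tensor norm as a seminorm. -/
def projSeminorm : Seminorm ℝ (X ⊗[ℝ] Y) :=
  Seminorm.ofSMulLE projNorm
    (le_antisymm (csInf_le (projValues_bddBelow _) ⟨0, Fin.elim0, Fin.elim0, by simp, by simp⟩)
      (Real.sInf_nonneg fun _ hr => projValues_nonneg hr))
    projNorm_add_le projNorm_smul_le

/-- The algebraic tensor product, to be equipped with the projective norm. -/
def ProjAlg : Type _ := X ⊗[ℝ] Y

instance : AddCommGroup (ProjAlg X Y) := inferInstanceAs (AddCommGroup (X ⊗[ℝ] Y))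
instance : Module ℝ (ProjAlg X Y) := inferInstanceAs (Module ℝ (X ⊗[ℝ] Y))

instance : SeminormedAddCommGroup (ProjAlg X Y) :=
  AddGroupSeminorm.toSeminormedAddCommGroup (E := ProjAlg X Y)
    (projSeminorm (X := X) (Y := Y)).toAddGroupSeminorm

instance : NormedSpace ℝ (ProjAlg X Y) where
  norm_smul_le a u := projNorm_smul_le a (show X ⊗[ℝ] Y from u)

/-- The projective tensor product: the completion of the algebraic tensor product with respect
to the projective norm. -/
abbrev ProjTensor : Type _ := UniformSpace.Completion (ProjAlg X Y)

variable {X Y} in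
/-- The simple tensor `x ⊗ y` in the projective tensor product. -/
def ProjTensor.tmul (x : X) (y : Y) : ProjTensor X Y :=
  ((show ProjAlg X Y from x ⊗ₜ[ℝ] y : ProjAlg X Y) : ProjTensor X Y)

variable {X Y Z} in
theorem norm_lift_le (B : X →L[ℝ] Y →L[ℝ] Z) (u : ProjAlg X Y) :
    ‖TensorProduct.lift B.toLinearMap₁₂ (show X ⊗[ℝ] Y from u)‖ ≤ ‖B‖ * ‖u‖ := by
  refine le_of_forall_pos_le_add fun ε hε => ?_
  obtain ⟨_, ⟨n, x, y, hu, rfl⟩, hu'⟩ :=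
    Real.lt_sInf_add_pos (projValues_nonempty (show X ⊗[ℝ] Y from u))
      (ε := ε / (‖B‖ + 1)) (by positivity)
  have h1 : ‖TensorProduct.lift B.toLinearMap₁₂ (show X ⊗[ℝ] Y from u)‖
      ≤ ‖B‖ * ∑ i, ‖x i‖ * ‖y i‖ := by
    rw [hu, map_sum, Finset.mul_sum]
    refine (norm_sum_le _ _).trans (Finset.sum_le_sum fun i _ => ?_)
    simpa [mul_assoc] using B.le_opNorm₂ (x i) (y i)
  have h2 : ‖B‖ * (ε / (‖B‖ + 1)) ≤ ε := by
    rw [mul_div_assoc', div_le_iff₀ (by positivity)]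
    nlinarith [norm_nonneg B]
  have h3 : ‖B‖ * ∑ i, ‖x i‖ * ‖y i‖ ≤ ‖B‖ * (‖u‖ + ε / (‖B‖ + 1)) :=
    mul_le_mul_of_nonneg_left hu'.le (norm_nonneg B)
  linarith

variable {X Y Z} in
/-- The lifting `B̂` of a bounded bilinear map on the algebraic tensor product. -/
def liftAlg (B : X →L[ℝ] Y →L[ℝ] Z) : ProjAlg X Y →L[ℝ] Z :=
  LinearMap.mkContinuous (E := ProjAlg X Y)
    (show ProjAlg X Y →ₗ[ℝ] Z from TensorProduct.lift B.toLinearMap₁₂) ‖B‖ (norm_lift_le B)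

variable {X Y Z} in
/-- The lifting `B̂` of a bounded bilinear map `B` to the projective tensor product. -/
def ProjTensor.lift [CompleteSpace Z] (B : X →L[ℝ] Y →L[ℝ] Z) : ProjTensor X Y →L[ℝ] Z :=
  (liftAlg B).extend (UniformSpace.Completion.toComplL : ProjAlg X Y →L[ℝ] ProjTensor X Y)

variable {X Y Z} in
theorem ProjTensor.lift_tmul [CompleteSpace Z] (B : X →L[ℝ] Y →L[ℝ] Z) (x : X) (y : Y) :
    ProjTensor.lift B (ProjTensor.tmul x y) = B x y := by
  have := ContinuousLinearMap.extend_eq (liftAlg B)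
    (e := (UniformSpace.Completion.toComplL : ProjAlg X Y →L[ℝ] ProjTensor X Y))
    UniformSpace.Completion.denseRange_coe
    (UniformSpace.Completion.isUniformInducing_coe _) (show ProjAlg X Y from x ⊗ₜ[ℝ] y)
  refine this.trans ?_
  exact TensorProduct.lift.tmul (f' := B.toLinearMap₁₂) x y

/-- A tensor `∑ xᵢ ⊗ yᵢ` as the bounded bilinear form `(φ, ψ) ↦ ∑ φ(xᵢ) ψ(yᵢ)` on the duals. -/
def tensorToBilin : X ⊗[ℝ] Y →ₗ[ℝ] (StrongDual ℝ X →L[ℝ] StrongDual ℝ Y →L[ℝ] ℝ) :=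
  TensorProduct.lift <| LinearMap.mk₂ ℝ
    (fun x y => (ContinuousLinearMap.smulRightL ℝ (StrongDual ℝ X) (StrongDual ℝ Y →L[ℝ] ℝ)
      (NormedSpace.inclusionInDoubleDual ℝ X x)) (NormedSpace.inclusionInDoubleDual ℝ Y y))
    (fun x x' y => by ext; simp)
    (fun a x y => by ext; simp)
    (fun x y y' => by ext; simp)
    (fun a x y => by ext; simp)

variable {X Y} in
@[simp] theorem tensorToBilin_tmul (x : X) (y : Y) (φ : StrongDual ℝ X) (ψ : StrongDual ℝ Y) :
    tensorToBilin X Y (x ⊗ₜ[ℝ] y) φ ψ = φ x * ψ y := by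
  simp [tensorToBilin]

/-- The algebraic tensor product, to be equipped with the injective norm. -/
def InjAlg : Type _ := X ⊗[ℝ] Y

instance : AddCommGroup (InjAlg X Y) := inferInstanceAs (AddCommGroup (X ⊗[ℝ] Y))
instance : Module ℝ (InjAlg X Y) := inferInstanceAs (Module ℝ (X ⊗[ℝ] Y))

/-- `tensorToBilin` as a map on `InjAlg X Y`. -/
def injBilin : InjAlg X Y →ₗ[ℝ] (StrongDual ℝ X →L[ℝ] StrongDual ℝ Y →L[ℝ] ℝ) :=
  tensorToBilin X Y

/-- The injective norm is the one induced by the space of bounded bilinear forms on the duals. -/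
instance : SeminormedAddCommGroup (InjAlg X Y) :=
  SeminormedAddCommGroup.induced _ _ (injBilin X Y)

instance : NormedSpace ℝ (InjAlg X Y) := NormedSpace.induced ℝ _ _ (injBilin X Y)

/-- The injective tensor product: the completion of the algebraic tensor product with respect
to the injective norm. -/
abbrev InjTensor : Type _ := UniformSpace.Completion (InjAlg X Y)

variable {X Y} in
/-- The simple tensor `x ⊗ y` in the injective tensor product. -/
def InjTensor.tmul (x : X) (y : Y) : InjTensor X Y :=
  ((show InjAlg X Y from x ⊗ₜ[ℝ] y : InjAlg X Y) : InjTensor X Y)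

/-- `injBilin` as a continuous linear map. -/
def injBilinL : InjAlg X Y →L[ℝ] (StrongDual ℝ X →L[ℝ] StrongDual ℝ Y →L[ℝ] ℝ) :=
  (injBilin X Y).mkContinuous 1 (fun u => by rw [one_mul]; exact le_of_eq rfl)

/-- The bounded bilinear form on the duals given by an element of the injective tensor product. -/
def InjTensor.toBilin : InjTensor X Y →L[ℝ] (StrongDual ℝ X →L[ℝ] StrongDual ℝ Y →L[ℝ] ℝ) :=
  (injBilinL X Y).extend
    (UniformSpace.Completion.toComplL : InjAlg X Y →L[ℝ] InjTensor X Y)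

variable {X Y} in
theorem InjTensor.toBilin_tmul (x : X) (y : Y) (φ : StrongDual ℝ X) (ψ : StrongDual ℝ Y) :
    InjTensor.toBilin X Y (InjTensor.tmul x y) φ ψ = φ x * ψ y := by
  have := ContinuousLinearMap.extend_eq (injBilinL X Y)
    (e := (UniformSpace.Completion.toComplL : InjAlg X Y →L[ℝ] InjTensor X Y))
    UniformSpace.Completion.denseRange_coe
    (UniformSpace.Completion.isUniformInducing_coe _) (show InjAlg X Y from x ⊗ₜ[ℝ] y)
  refine (congrArg (fun b => b φ ψ) this).trans ?_
  exact tensorToBilin_tmul x y φ ψ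

/-- The bounded bilinear map sending `(φ, ψ)` to the functional on the injective tensor
product given on simple tensors by `x ⊗ y ↦ φ(x) ψ(y)`. -/
def dualTensor : StrongDual ℝ X →L[ℝ] StrongDual ℝ Y →L[ℝ] StrongDual ℝ (InjTensor X Y) :=
  (ContinuousLinearMap.flipₗᵢ ℝ (InjTensor X Y) (StrongDual ℝ Y) ℝ
    |>.toLinearIsometry.toContinuousLinearMap).comp
    (InjTensor.toBilin X Y).flip

variable {X Y} in
theorem dualTensor_apply (φ : StrongDual ℝ X) (ψ : StrongDual ℝ Y) (u : InjTensor X Y) :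
    dualTensor X Y φ ψ u = InjTensor.toBilin X Y u φ ψ := rfl

end Tensor

/-! ### The space of finite signed measures, and its pairing with `C₀` -/

theorem norm_zeroAtInfty_apply_le {T : Type*} [TopologicalSpace T] {F : Type*} [NormedAddCommGroup F] (f : C₀(T, F)) (t : T) :
    ‖f t‖ ≤ ‖f‖ := by
  rw [← ZeroAtInftyContinuousMap.norm_toBCF_eq_norm]
  exact f.toBCF.norm_coe_le_norm t

theorem norm_zeroAtInfty_le {T : Type*} [TopologicalSpace T] {F : Type*} [NormedAddCommGroup F]
    (f : C₀(T, F)) (C : ℝ) (hC : 0 ≤ C) (h : ∀ t, ‖f t‖ ≤ C) : ‖f‖ ≤ C := by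
  rw [← ZeroAtInftyContinuousMap.norm_toBCF_eq_norm]
  exact (BoundedContinuousFunction.norm_le hC).2 h

section Radon

variable (T : Type*) [MeasurableSpace T]

/-- The space of finite signed measures on `T`, to be normed by the total variation. On an open
subset of a Euclidean space with its Borel sets, these are exactly the finite signed Radon
measures. -/
def RadonMeasure : Type _ := SignedMeasure T

instance : AddCommGroup (RadonMeasure T) := inferInstanceAs (AddCommGroup (SignedMeasure T))
instance : Module ℝ (RadonMeasure T) := inferInstanceAs (Module ℝ (SignedMeasure T))

variable {T} in
/-- An element of `RadonMeasure T` as a signed measure. -/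
def RadonMeasure.toSigned (c : RadonMeasure T) : SignedMeasure T := c

instance isFiniteMeasure_variation_signed (c : SignedMeasure T) :
    IsFiniteMeasure c.variation := by
  rw [← SignedMeasure.totalVariation_eq_variation, SignedMeasure.totalVariation]
  infer_instance

/-- The total variation norm. -/
instance : NormedAddCommGroup (RadonMeasure T) :=
  AddGroupNorm.toNormedAddCommGroup (E := RadonMeasure T)
    { toFun := fun c => c.toSigned.variation.real univ
      map_zero' := by
        change (0 : SignedMeasure T).variation.real univ = 0
        simp
      add_le' := fun c c' => by
        have h := VectorMeasure.variation_add_le (μ := c.toSigned) (ν := c'.toSigned)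
        have h' := ENNReal.toReal_mono (measure_ne_top _ _) (h univ)
        rw [Measure.add_apply, ENNReal.toReal_add (measure_ne_top _ _) (measure_ne_top _ _)] at h'
        exact h'
      neg' := fun c => by
        change (-c.toSigned).variation.real univ = _
        rw [VectorMeasure.variation_neg]
      eq_zero_of_map_eq_zero' := fun c hc => by
        rw [measureReal_eq_zero_iff] at hc
        have := Measure.measure_univ_eq_zero.1 hc
        exact VectorMeasure.variation_eq_zero.1 this }

instance : NormedSpace ℝ (RadonMeasure T) where
  norm_smul_le a c := by
    change (a • c.toSigned).variation.real univ ≤ ‖a‖ * c.toSigned.variation.real univ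
    rw [VectorMeasure.variation_smul]
    simp [measureReal_def]

variable {T}

theorem RadonMeasure.integrable_of_bounded {F : Type*} [NormedAddCommGroup F] [TopologicalSpace T] [BorelSpace T]
    [SecondCountableTopology T] (c : RadonMeasure T) {f : T → F} (hf : Continuous f) (C : ℝ)
    (hC : ∀ t, ‖f t‖ ≤ C) : c.toSigned.Integrable f := by
  refine Integrable.of_bound (C := C) ?_ (Eventually.of_forall hC)
  exact hf.aestronglyMeasurable

variable {E : Type*} [NormedAddCommGroup E] [NormedSpace ℝ E]

/-- The integral `∫ f dc` of a (vector-valued) function against a finite signed measure. -/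
def RadonMeasure.integral (c : RadonMeasure T) (f : T → E) : E :=
  VectorMeasure.integral c.toSigned f (ContinuousLinearMap.lsmul ℝ ℝ).flip

namespace RadonMeasure

theorem norm_integral_le (c : RadonMeasure T) (f : T → E) (C : ℝ) (hC : 0 ≤ C)
    (hf : ∀ t, ‖f t‖ ≤ C) : ‖c.integral f‖ ≤ ‖c‖ * C := by
  refine (VectorMeasure.norm_integral_le_of_norm_le_const (Eventually.of_forall hf)).trans ?_
  have h : ‖(ContinuousLinearMap.lsmul ℝ ℝ : ℝ →L[ℝ] E →L[ℝ] E).flip‖ ≤ 1 := by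
    rw [ContinuousLinearMap.opNorm_flip]
    exact ContinuousLinearMap.opNorm_lsmul_le
  have h2 : 0 ≤ ‖c‖ := norm_nonneg c
  change C * _ * ‖c‖ ≤ ‖c‖ * C
  nlinarith [mul_nonneg hC h2]

theorem integral_add_measure (c c' : RadonMeasure T) {f : T → E} (hf : c.toSigned.Integrable f)
    (hf' : c'.toSigned.Integrable f) : (c + c').integral f = c.integral f + c'.integral f :=
  VectorMeasure.integral_add_vectorMeasure hf hf'

theorem integral_smul_measure (a : ℝ) (c : RadonMeasure T) (f : T → E) :
    (a • c).integral f = a • c.integral f :=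
  VectorMeasure.integral_smul_vectorMeasure f a

theorem integral_add (c : RadonMeasure T) {f g : T → E} (hf : c.toSigned.Integrable f)
    (hg : c.toSigned.Integrable g) :
    c.integral (fun t => f t + g t) = c.integral f + c.integral g :=
  VectorMeasure.integral_fun_add hf hg

theorem integral_smul (c : RadonMeasure T) (a : ℝ) (f : T → E) :
    c.integral (fun t => a • f t) = a • c.integral f :=
  VectorMeasure.integral_fun_smul (μ := c.toSigned) (B := (ContinuousLinearMap.lsmul ℝ ℝ).flip) a f

theorem integral_eq_sub (c : RadonMeasure T) {f : T → E} (hf : c.toSigned.Integrable f) :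
    c.integral f = ∫ t, f t ∂c.toSigned.toJordanDecomposition.posPart
      - ∫ t, f t ∂c.toSigned.toJordanDecomposition.negPart := by
  have htot : c.toSigned.variation = c.toSigned.toJordanDecomposition.posPart
      + c.toSigned.toJordanDecomposition.negPart :=
    (SignedMeasure.totalVariation_eq_variation c.toSigned).symm
  have hf' := hf
  rw [VectorMeasure.Integrable, htot, integrable_add_measure] at hf'
  have h := SignedMeasure.toSignedMeasure_toJordanDecomposition c.toSigned
  unfold RadonMeasure.integral
  conv_lhs => rw [← h]
  unfold JordanDecomposition.toSignedMeasure
  rw [VectorMeasure.integral_sub_vectorMeasure]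
  · simp [VectorMeasure.integral_toSignedMeasure]
  · rw [VectorMeasure.Integrable, Measure.variation_toSignedMeasure]; exact hf'.1
  · rw [VectorMeasure.Integrable, Measure.variation_toSignedMeasure]; exact hf'.2

theorem map_integral [CompleteSpace E] {F : Type*} [NormedAddCommGroup F] [NormedSpace ℝ F]
    [CompleteSpace F] (c : RadonMeasure T) {f : T → E} (hf : c.toSigned.Integrable f)
    (L : E →L[ℝ] F) : L (c.integral f) = c.integral (fun t => L (f t)) := by
  rw [integral_eq_sub c hf, integral_eq_sub c (L.integrable_comp hf), map_sub]
  have htot : c.toSigned.variation = c.toSigned.toJordanDecomposition.posPart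
      + c.toSigned.toJordanDecomposition.negPart :=
    (SignedMeasure.totalVariation_eq_variation c.toSigned).symm
  rw [VectorMeasure.Integrable, htot, integrable_add_measure] at hf
  rw [L.integral_comp_comm hf.1, L.integral_comp_comm hf.2]

end RadonMeasure

variable [TopologicalSpace T] [BorelSpace T] [SecondCountableTopology T]

variable (T) in
/-- A finite signed measure as a functional on `C₀(T)`, namely `f ↦ ∫ f dc`. -/
def RadonMeasure.toDual : RadonMeasure T →L[ℝ] StrongDual ℝ C₀(T, ℝ) :=
  LinearMap.mkContinuous₂
    (LinearMap.mk₂ ℝ (fun (c : RadonMeasure T) (f : C₀(T, ℝ)) => c.integral f)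
      (fun c c' f => c.integral_add_measure c'
        (c.integrable_of_bounded f.continuous _ (norm_zeroAtInfty_apply_le f))
        (c'.integrable_of_bounded f.continuous _ (norm_zeroAtInfty_apply_le f)))
      (fun a c f => c.integral_smul_measure a f)
      (fun c f g => c.integral_add
        (c.integrable_of_bounded f.continuous _ (norm_zeroAtInfty_apply_le f))
        (c.integrable_of_bounded g.continuous _ (norm_zeroAtInfty_apply_le g)))
      (fun a c f => c.integral_smul a f))
    1 (fun c f => by
      rw [one_mul]
      exact c.norm_integral_le f _ (norm_nonneg _) (norm_zeroAtInfty_apply_le f))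

theorem RadonMeasure.toDual_apply (c : RadonMeasure T) (f : C₀(T, ℝ)) :
    RadonMeasure.toDual T c f = c.integral f := rfl

end Radon

/-! ### The injective tensor product of `C₀(T)` and `X` inside `C₀(T, X)` -/

section Inj

variable (T X : Type*) [TopologicalSpace T] [NormedAddCommGroup X] [NormedSpace ℝ X]

variable {T X} in
/-- Composition of a function in `C₀(T, X)` with a bounded linear map. -/
def compC0 {Y : Type*} [NormedAddCommGroup Y] [NormedSpace ℝ Y] (L : X →L[ℝ] Y) (f : C₀(T, X)) :
    C₀(T, Y) where
  toFun t := L (f t)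
  continuous_toFun := L.continuous.comp f.continuous
  zero_at_infty' := by
    have := (L.continuous.tendsto 0).comp (zero_at_infty f)
    rw [map_zero] at this
    exact this

variable {T X} in
/-- The function `t ↦ f(t) x` in `C₀(T, X)`. -/
def simpleC0 (f : C₀(T, ℝ)) (x : X) : C₀(T, X) :=
  compC0 ((ContinuousLinearMap.id ℝ ℝ).smulRight x) f

variable {T X} in
@[simp] theorem simpleC0_apply (f : C₀(T, ℝ)) (x : X) (t : T) : simpleC0 f x t = f t • x := rfl

/-- The map `J (∑ fᵢ ⊗ xᵢ) (t) = ∑ fᵢ(t) xᵢ` on the algebraic tensor product. -/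
def injToC0Alg : InjAlg C₀(T, ℝ) X →ₗ[ℝ] C₀(T, X) :=
  show C₀(T, ℝ) ⊗[ℝ] X →ₗ[ℝ] C₀(T, X) from
  TensorProduct.lift <| LinearMap.mk₂ ℝ simpleC0
    (fun f g x => by ext t; simp [add_smul])
    (fun a f x => by ext t; simp [mul_smul])
    (fun f x y => by ext t; simp)
    (fun a f x => by ext t; exact smul_comm (f t) a x)

theorem injToC0Alg_tmul (f : C₀(T, ℝ)) (x : X) :
    injToC0Alg T X (show InjAlg C₀(T, ℝ) X from f ⊗ₜ[ℝ] x) = simpleC0 f x :=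
  TensorProduct.lift.tmul ..

theorem injBilin_apply_eq (u : InjAlg C₀(T, ℝ) X) (φ : StrongDual ℝ C₀(T, ℝ))
    (ψ : StrongDual ℝ X) :
    injBilin C₀(T, ℝ) X u φ ψ = φ (compC0 ψ (injToC0Alg T X u)) := by
  change tensorToBilin C₀(T, ℝ) X u φ ψ = _
  refine TensorProduct.induction_on
    (motive := fun u => tensorToBilin C₀(T, ℝ) X u φ ψ = φ (compC0 ψ (injToC0Alg T X u))) u ?_ ?_ ?_
  · have : compC0 ψ (0 : C₀(T, X)) = 0 := by ext t; simp [compC0]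
    rw [map_zero]
    erw [map_zero]
    simp [this]
  · intro f x
    rw [tensorToBilin_tmul]
    erw [injToC0Alg_tmul]
    have : compC0 ψ (simpleC0 f x) = ψ x • f := by
      ext t
      simp [compC0, simpleC0, mul_comm]
    rw [this, map_smul, smul_eq_mul, mul_comm]
  · intro u v hu hv
    rw [map_add]
    erw [map_add]
    have : ∀ f g : C₀(T, X), compC0 ψ (f + g) = compC0 ψ f + compC0 ψ g := by
      intro f g; ext t; simp [compC0]
    rw [this, map_add, ← hu, ← hv]
    rfl

/-- Point evaluation on `C₀(T)`. -/
def evalC0 (t : T) : StrongDual ℝ C₀(T, ℝ) :=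
  LinearMap.mkContinuous
    { toFun := fun f => f t, map_add' := fun _ _ => rfl, map_smul' := fun _ _ => rfl } 1
    (fun f => by
      rw [one_mul]
      exact norm_zeroAtInfty_apply_le f t)

theorem norm_injToC0Alg (u : InjAlg C₀(T, ℝ) X) : ‖injToC0Alg T X u‖ = ‖u‖ := by
  have hu : ‖u‖ = ‖injBilin C₀(T, ℝ) X u‖ := rfl
  rw [hu]
  apply le_antisymm
  · refine norm_zeroAtInfty_le _ _ (norm_nonneg _) fun t => ?_
    obtain ⟨g, hg, hg'⟩ := exists_dual_vector'' ℝ (injToC0Alg T X u t)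
    have h1 : injBilin C₀(T, ℝ) X u (evalC0 T t) g = ‖injToC0Alg T X u t‖ := by
      rw [injBilin_apply_eq]
      simpa [evalC0, compC0] using hg'
    have h2 := (injBilin C₀(T, ℝ) X u).le_opNorm₂ (evalC0 T t) g
    have h3 : ‖evalC0 T t‖ ≤ 1 := LinearMap.mkContinuous_norm_le _ zero_le_one _
    rw [h1, norm_norm] at h2
    refine h2.trans ?_
    calc ‖injBilin C₀(T, ℝ) X u‖ * ‖evalC0 T t‖ * ‖g‖
        ≤ ‖injBilin C₀(T, ℝ) X u‖ * 1 * 1 := by gcongr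
      _ = _ := by ring
  · refine ContinuousLinearMap.opNorm_le_bound₂ _ (norm_nonneg _) fun φ ψ => ?_
    rw [injBilin_apply_eq]
    have h1 : ‖compC0 ψ (injToC0Alg T X u)‖ ≤ ‖ψ‖ * ‖injToC0Alg T X u‖ := by
      refine norm_zeroAtInfty_le _ _ (mul_nonneg (norm_nonneg _) (norm_nonneg _)) fun t => ?_
      refine (ψ.le_opNorm _).trans ?_
      gcongr
      exact norm_zeroAtInfty_apply_le _ t
    calc ‖φ (compC0 ψ (injToC0Alg T X u))‖ ≤ ‖φ‖ * ‖compC0 ψ (injToC0Alg T X u)‖ := φ.le_opNorm _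
      _ ≤ ‖φ‖ * (‖ψ‖ * ‖injToC0Alg T X u‖) := by gcongr
      _ = _ := by ring

/-- `injToC0Alg` as a continuous linear map. -/
def injToC0AlgL : InjAlg C₀(T, ℝ) X →L[ℝ] C₀(T, X) :=
  (injToC0Alg T X).mkContinuous 1 (fun u => by rw [one_mul, norm_injToC0Alg])

variable [CompleteSpace X]

/-- The canonical isometry `J : C₀(T) ⊗ᵢ X → C₀(T, X)` with `J (f ⊗ x) (t) = f(t) x`. -/
def injToC0 : InjTensor C₀(T, ℝ) X →ₗᵢ[ℝ] C₀(T, X) where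
  toLinearMap := ((injToC0AlgL T X).extend
    (UniformSpace.Completion.toComplL :
      InjAlg C₀(T, ℝ) X →L[ℝ] InjTensor C₀(T, ℝ) X)).toLinearMap
  norm_map' u := by
    refine UniformSpace.Completion.induction_on u
      (isClosed_eq (ContinuousLinearMap.continuous _).norm continuous_norm) fun v => ?_
    rw [UniformSpace.Completion.norm_coe, ← norm_injToC0Alg]
    exact congrArg norm (ContinuousLinearMap.extend_eq (injToC0AlgL T X)
      (e := (UniformSpace.Completion.toComplL :
        InjAlg C₀(T, ℝ) X →L[ℝ] InjTensor C₀(T, ℝ) X))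
      UniformSpace.Completion.denseRange_coe
      (UniformSpace.Completion.isUniformInducing_coe _) v)

theorem injToC0_tmul (f : C₀(T, ℝ)) (x : X) (t : T) :
    injToC0 T X (InjTensor.tmul f x) t = f t • x := by
  have := ContinuousLinearMap.extend_eq (injToC0AlgL T X)
      (e := (UniformSpace.Completion.toComplL :
        InjAlg C₀(T, ℝ) X →L[ℝ] InjTensor C₀(T, ℝ) X))
      UniformSpace.Completion.denseRange_coe
      (UniformSpace.Completion.isUniformInducing_coe _) (show InjAlg C₀(T, ℝ) X from f ⊗ₜ[ℝ] x)
  refine (congrArg (fun g : C₀(T, X) => g t) this).trans ?_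
  exact congrArg (fun g : C₀(T, X) => g t) (injToC0Alg_tmul T X f x)

end Inj

/-! ### The convolution operator and its lifting -/

section Convolution

variable {d : ℕ}

/-- The extension `{x | ∃ y ∈ S, x - y ∈ Ω}` of `Ω` by `S`. -/
def extDomain (Ω S : Set (EuclideanSpace ℝ (Fin d))) : Set (EuclideanSpace ℝ (Fin d)) :=
  {x | ∃ y ∈ S, x - y ∈ Ω}

/-- The space `L^r(A)` of real functions with respect to Lebesgue measure. -/
abbrev LpOn (r : ℝ≥0∞) (A : Set (EuclideanSpace ℝ (Fin d))) : Type :=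
  Lp ℝ r ((volume : Measure (EuclideanSpace ℝ (Fin d))).restrict A)

/-- The space `X_s = M(Ω_S) ⊗_π L^s(S)`. -/
abbrev LiftSpace (Ω S : Set (EuclideanSpace ℝ (Fin d))) (s : ℝ≥0∞) [Fact (1 ≤ s)] : Type :=
  ProjTensor (RadonMeasure (extDomain Ω S)) (LpOn s S)

/-- The space `C₀(Ω_S) ⊗ᵢ L^{s'}(S)`. -/
abbrev PredualSpace (Ω S : Set (EuclideanSpace ℝ (Fin d))) (s' : ℝ≥0∞) [Fact (1 ≤ s')] : Type :=
  InjTensor C₀(extDomain Ω S, ℝ) (LpOn s' S)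

/-- The duality pairing `(f, g) = ∫_A f g` between `L^r(A)` and `L^{r'}(A)`. -/
def lpDual (A : Set (EuclideanSpace ℝ (Fin d))) (r r' : ℝ≥0∞) [Fact (1 ≤ r)] [Fact (1 ≤ r')]
    [ENNReal.HolderConjugate r r'] : LpOn r A →L[ℝ] StrongDual ℝ (LpOn r' A) :=
  (ContinuousLinearMap.mul ℝ ℝ).lpPairing (volume.restrict A) r r'

theorem lpDual_apply (A : Set (EuclideanSpace ℝ (Fin d))) (r r' : ℝ≥0∞) [Fact (1 ≤ r)]
    [Fact (1 ≤ r')] [ENNReal.HolderConjugate r r'] (f : LpOn r A) (g : LpOn r' A) :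
    lpDual A r r' f g = ∫ x in A, f x * g x :=
  ContinuousLinearMap.lpPairing_eq_integral _ f g

theorem memLp_zeroExt {S : Set (EuclideanSpace ℝ (Fin d))} {q s : ℝ≥0∞} (hS : MeasurableSet S) (hSb : Bornology.IsBounded S) (hqs : q ≤ s)
    (p : LpOn s S) :
    MemLp (S.indicator p) q (volume : Measure (EuclideanSpace ℝ (Fin d))) := by
  rw [memLp_indicator_iff_restrict hS]
  have : IsFiniteMeasure ((volume : Measure (EuclideanSpace ℝ (Fin d))).restrict S) :=
    isFiniteMeasure_restrict.2 hSb.measure_lt_top.ne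
  exact (Lp.memLp p).mono_exponent hqs

variable (Ω S : Set (EuclideanSpace ℝ (Fin d))) (q s q' s' : ℝ≥0∞)
  [Fact (1 ≤ q)] [Fact (1 ≤ s)] [Fact (1 ≤ q')] [Fact (1 ≤ s')]

/-- The canonical duality `⟨c ⊗ p, f ⊗ g⟩ = (c, f) (p, g)` between `M(Ω_S) ⊗_π L^s(S)` and
`C₀(Ω_S) ⊗ᵢ L^{s'}(S)`. -/
def liftPairing [ENNReal.HolderConjugate s s'] :
    LiftSpace Ω S s →L[ℝ] StrongDual ℝ (PredualSpace Ω S s') :=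
  ProjTensor.lift
    ((dualTensor C₀(extDomain Ω S, ℝ) (LpOn s' S)).bilinearComp
      (RadonMeasure.toDual (extDomain Ω S)) (lpDual S s s'))

theorem liftPairing_tmul [ENNReal.HolderConjugate s s'] (c : RadonMeasure (extDomain Ω S))
    (p : LpOn s S) (f : C₀(extDomain Ω S, ℝ)) (g : LpOn s' S) :
    liftPairing Ω S s s' (ProjTensor.tmul c p) (InjTensor.tmul f g)
      = c.integral f * ∫ x in S, p x * g x := by
  unfold liftPairing
  rw [ProjTensor.lift_tmul]
  refine (dualTensor_apply _ _ _).trans ?_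
  rw [InjTensor.toBilin_tmul]
  exact congrArg (c.integral f * ·) (lpDual_apply S s s' p g)

/-- `M(Ω_S) ⊗_π L^s(S)` with its weak* topology as the dual of `C₀(Ω_S) ⊗ᵢ L^{s'}(S)`: the coarsest
topology for which `u ↦ ⟨u, ψ⟩` is continuous for all `ψ`. -/
abbrev LiftSpaceWeakStar [ENNReal.HolderConjugate s s'] : Type :=
  WeakBilin (liftPairing Ω S s s').toLinearMap₁₂

/-- The canonical map of `C₀(Ω_S) ⊗ᵢ L^{s'}(S)` into the dual of `M(Ω_S) ⊗_π L^s(S)`. -/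
def predualToDual [ENNReal.HolderConjugate s s'] :
    PredualSpace Ω S s' →L[ℝ] StrongDual ℝ (LiftSpace Ω S s) :=
  (liftPairing Ω S s s').flip

variable {S q s} in
/-- The zero extension of functions as a bounded map from `L^s(S)` to `L^q(ℝᵈ)`. -/
def zeroExtLp (hS : MeasurableSet S) (hSb : Bornology.IsBounded S) (hqs : q ≤ s) :
    LpOn s S →L[ℝ] Lp ℝ q (volume : Measure (EuclideanSpace ℝ (Fin d))) :=
  LinearMap.mkContinuous
    { toFun := fun p => (memLp_zeroExt hS hSb hqs p).toLp _
      map_add' := fun p p' => by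
        rw [← MemLp.toLp_add]
        refine MemLp.toLp_congr _ _ ?_
        rw [← indicator_add']
        exact (ae_eq_restrict_iff_indicator_ae_eq hS).1 (Lp.coeFn_add p p')
      map_smul' := fun a p => by
        rw [RingHom.id_apply, ← MemLp.toLp_const_smul]
        refine MemLp.toLp_congr _ _ ?_
        have h : a • S.indicator (p : EuclideanSpace ℝ (Fin d) → ℝ) =
              S.indicator (a • (p : EuclideanSpace ℝ (Fin d) → ℝ)) := by
          funext x; by_cases hx : x ∈ S <;> simp [hx]
        rw [h]
        exact (ae_eq_restrict_iff_indicator_ae_eq hS).1 (Lp.coeFn_smul a p) }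
    ((volume S) ^ (1 / q.toReal - 1 / s.toReal)).toReal (fun p => by
      have hfin : (volume S) ^ (1 / q.toReal - 1 / s.toReal) ≠ ∞ := by
        rcases eq_or_ne s ∞ with rfl | hs
        · refine ENNReal.rpow_ne_top_of_nonneg ?_ hSb.measure_lt_top.ne
          simp
        · refine ENNReal.rpow_ne_top_of_nonneg ?_ hSb.measure_lt_top.ne
          have hq1 : (1 : ℝ) ≤ q.toReal := by
            simpa using ENNReal.toReal_mono (ne_top_of_le_ne_top hs hqs) (Fact.out : 1 ≤ q)
          exact sub_nonneg.2 (one_div_le_one_div_of_le (by linarith)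
            (ENNReal.toReal_mono hs hqs))
      change ‖(memLp_zeroExt hS hSb hqs p).toLp _‖ ≤ _
      rw [Lp.norm_toLp, Lp.norm_def, ← ENNReal.toReal_mul, eLpNorm_indicator_eq_eLpNorm_restrict hS]
      refine ENNReal.toReal_mono (ENNReal.mul_ne_top hfin (Lp.eLpNorm_ne_top p)) ?_
      refine (eLpNorm_le_eLpNorm_mul_rpow_measure_univ hqs
        (Lp.aestronglyMeasurable p)).trans (le_of_eq ?_)
      rw [Measure.restrict_apply_univ, mul_comm])

/-- The translation `f ↦ f(· - y)` on `L^q(ℝᵈ)`. -/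
def translateLp (y : EuclideanSpace ℝ (Fin d)) :
    Lp ℝ q (volume : Measure (EuclideanSpace ℝ (Fin d))) →ₗᵢ[ℝ]
      Lp ℝ q (volume : Measure (EuclideanSpace ℝ (Fin d))) :=
  Lp.compMeasurePreservingₗᵢ ℝ (fun x => x - y) (measurePreserving_sub_right volume y)

variable {S q s} in
/-- The atom `p` placed at `y`, that is the function `x ↦ p̃(x - y)` in `L^q(Ω)`, where `p̃` is the
zero extension of `p`. -/
def placedAtom (hS : MeasurableSet S) (hSb : Bornology.IsBounded S) (hqs : q ≤ s)
    (y : EuclideanSpace ℝ (Fin d)) : LpOn s S →L[ℝ] LpOn q Ω :=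
  (LpToLpRestrictCLM (EuclideanSpace ℝ (Fin d)) ℝ ℝ volume q Ω).comp
    ((translateLp q y).toContinuousLinearMap.comp (zeroExtLp hS hSb hqs))

variable {S q s}

theorem placedAtom_ae (hS : MeasurableSet S) (hSb : Bornology.IsBounded S) (hqs : q ≤ s)
    (y : EuclideanSpace ℝ (Fin d)) (p : LpOn s S) :
    placedAtom Ω hS hSb hqs y p =ᵐ[volume.restrict Ω] fun x => S.indicator p (x - y) := by
  have h1 := LpToLpRestrictCLM_coeFn ℝ Ω (translateLp q y (zeroExtLp hS hSb hqs p))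
  have h2 := ae_restrict_of_ae (s := Ω) (Lp.coeFn_compMeasurePreserving (zeroExtLp hS hSb hqs p)
    (measurePreserving_sub_right volume y))
  have h3 := ae_restrict_of_ae (s := Ω)
    ((measurePreserving_sub_right volume y).quasiMeasurePreserving.ae_eq_comp
    (MemLp.coeFn_toLp (memLp_zeroExt hS hSb hqs p)))
  exact (h1.trans h2).trans h3

theorem norm_placedAtom_le (hS : MeasurableSet S) (hSb : Bornology.IsBounded S) (hqs : q ≤ s)
    (y : EuclideanSpace ℝ (Fin d)) (p : LpOn s S) :
    ‖placedAtom Ω hS hSb hqs y p‖ ≤ ‖zeroExtLp hS hSb hqs‖ * ‖p‖ := by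
  refine (norm_Lp_toLp_restrict_le Ω _).trans ?_
  change ‖translateLp q y (zeroExtLp hS hSb hqs p)‖ ≤ _
  rw [LinearIsometry.norm_map]
  exact ContinuousLinearMap.le_opNorm _ _

theorem continuous_placedAtom (hS : MeasurableSet S) (hSb : Bornology.IsBounded S) (hqs : q ≤ s)
    (hq : q ≠ ∞) (p : LpOn s S) : Continuous fun y => placedAtom Ω hS hSb hqs y p := by
  refine (LpToLpRestrictCLM (EuclideanSpace ℝ (Fin d)) ℝ ℝ volume q Ω).continuous.comp ?_
  let g : C(EuclideanSpace ℝ (Fin d) × EuclideanSpace ℝ (Fin d), EuclideanSpace ℝ (Fin d)) :=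
    ⟨fun z => z.2 - z.1, by fun_prop⟩
  exact Continuous.compMeasurePreservingLp (f := fun _ => zeroExtLp hS hSb hqs p)
    continuous_const g.curry.continuous (measurePreserving_sub_right volume) hq

theorem integrable_placedAtom (hS : MeasurableSet S) (hSb : Bornology.IsBounded S) (hqs : q ≤ s)
    (hq : q ≠ ∞) (c : RadonMeasure (extDomain Ω S)) (p : LpOn s S) :
    c.toSigned.Integrable fun y => placedAtom Ω hS hSb hqs (y : EuclideanSpace ℝ (Fin d)) p :=
  c.integrable_of_bounded
    ((continuous_placedAtom Ω hS hSb hqs hq p).comp continuous_subtype_val) _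
    (fun _ => norm_placedAtom_le Ω hS hSb hqs _ p)

/-- The convolution operator `K(c, p) = ∫ p̃(· - y) dc(y)`, as a bounded bilinear map from
`M(Ω_S) × L^s(S)` to `L^q(Ω)`. The integral is taken in `L^q(Ω)`; by `integral_convBilin_mul`
below, `K(c, p)` is the function representing the functional `convFunctional c p`. -/
def convBilin (hS : MeasurableSet S) (hSb : Bornology.IsBounded S) (hqs : q ≤ s) (hq : q ≠ ∞) :
    RadonMeasure (extDomain Ω S) →L[ℝ] LpOn s S →L[ℝ] LpOn q Ω :=
  LinearMap.mkContinuous₂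
    (LinearMap.mk₂ ℝ
      (fun (c : RadonMeasure (extDomain Ω S)) (p : LpOn s S) =>
        c.integral fun y => placedAtom Ω hS hSb hqs (y : EuclideanSpace ℝ (Fin d)) p)
      (fun c c' p => c.integral_add_measure c' (integrable_placedAtom Ω hS hSb hqs hq c p)
        (integrable_placedAtom Ω hS hSb hqs hq c' p))
      (fun a c p => c.integral_smul_measure a _)
      (fun c p p' => by
        simp only [map_add]
        exact c.integral_add (integrable_placedAtom Ω hS hSb hqs hq c p)
          (integrable_placedAtom Ω hS hSb hqs hq c p'))
      (fun a c p => by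
        simp only [map_smul]
        exact c.integral_smul a _))
    ‖zeroExtLp (q := q) (s := s) hS hSb hqs‖ (fun c p => by
      refine (c.norm_integral_le _ _ (by positivity)
        (fun y => norm_placedAtom_le Ω hS hSb hqs _ p)).trans (le_of_eq ?_)
      ring)

variable {Ω} in
/-- The functional `h ↦ ∫ ∫ h̃(z + y) p̃(z) dz dc(y)`, where `h̃` and `p̃` are the zero extensions of
`h` from `Ω` and `p` from `S`. -/
def convFunctional (c : RadonMeasure (extDomain Ω S)) (p : LpOn s S)
    (h : EuclideanSpace ℝ (Fin d) → ℝ) : ℝ :=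
  c.integral fun y => ∫ z, Ω.indicator h (z + (y : EuclideanSpace ℝ (Fin d))) * S.indicator p z

variable {q'}

/-- `K(c, p)` is the function in `L^q(Ω)` that represents `convFunctional c p`. -/
theorem integral_convBilin_mul [ENNReal.HolderConjugate q q'] (hΩ : MeasurableSet Ω)
    (hS : MeasurableSet S) (hSb : Bornology.IsBounded S) (hqs : q ≤ s) (hq : q ≠ ∞)
    (c : RadonMeasure (extDomain Ω S)) (p : LpOn s S) (h : LpOn q' Ω) :
    ∫ x in Ω, convBilin Ω hS hSb hqs hq c p x * h x = convFunctional c p h := by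
  rw [← lpDual_apply]
  have h1 := c.map_integral (integrable_placedAtom Ω hS hSb hqs hq c p)
    ((lpDual Ω q q').flip h)
  refine h1.trans (congrArg c.integral (funext fun y => ?_))
  refine (lpDual_apply Ω q q' _ h).trans ?_
  have h2 : ∫ x in Ω, placedAtom Ω hS hSb hqs (y : EuclideanSpace ℝ (Fin d)) p x * h x
      = ∫ x in Ω, S.indicator p (x - y) * h x := by
    refine integral_congr_ae ?_
    filter_upwards [placedAtom_ae Ω hS hSb hqs y p] with x hx
    rw [hx]
  rw [h2, ← integral_indicator hΩ, ← integral_add_right_eq_self _ (y : EuclideanSpace ℝ (Fin d))]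
  refine integral_congr_ae (Eventually.of_forall fun z => ?_)
  by_cases hz : z + (y : EuclideanSpace ℝ (Fin d)) ∈ Ω
  · simp [hz, mul_comm]
  · simp [hz]

/-- The lifting `K̂ : M(Ω_S) ⊗_π L^s(S) → L^q(Ω)` of the convolution operator. -/
def convLift (hS : MeasurableSet S) (hSb : Bornology.IsBounded S) (hqs : q ≤ s) (hq : q ≠ ∞) :
    LiftSpace Ω S s →L[ℝ] LpOn q Ω :=
  ProjTensor.lift (convBilin Ω hS hSb hqs hq)

variable (q') in
/-- The adjoint `K̂* : L^{q'}(Ω) → (M(Ω_S) ⊗_π L^s(S))*`, given by `⟨K̂* h, u⟩ = (K̂ u, h)`. -/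
def convLiftAdjoint [ENNReal.HolderConjugate q q'] (hS : MeasurableSet S)
    (hSb : Bornology.IsBounded S) (hqs : q ≤ s) (hq : q ≠ ∞) :
    LpOn q' Ω →L[ℝ] StrongDual ℝ (LiftSpace Ω S s) :=
  ((lpDual Ω q q').comp (convLift Ω hS hSb hqs hq)).flip

theorem convLiftAdjoint_apply [ENNReal.HolderConjugate q q'] (hS : MeasurableSet S)
    (hSb : Bornology.IsBounded S) (hqs : q ≤ s) (hq : q ≠ ∞) (h : LpOn q' Ω)
    (u : LiftSpace Ω S s) :
    convLiftAdjoint Ω q' hS hSb hqs hq h u = ∫ x in Ω, convLift Ω hS hSb hqs hq u x * h x :=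
  lpDual_apply Ω q q' _ h

variable {Ω}

open Classical in
/-- The extension of `φ : Ω → ℝ` by zero to `ℝᵈ`. -/
def zeroExt (φ : Ω → ℝ) (x : EuclideanSpace ℝ (Fin d)) : ℝ :=
  if h : x ∈ Ω then φ ⟨x, h⟩ else 0

theorem memLp_zeroExt_C0 {r : ℝ≥0∞} (hΩ : MeasurableSet Ω) (hΩb : Bornology.IsBounded Ω) (φ : C₀(Ω, ℝ)) :
    MemLp (zeroExt φ) r ((volume : Measure (EuclideanSpace ℝ (Fin d))).restrict Ω) := by
  have : IsFiniteMeasure ((volume : Measure (EuclideanSpace ℝ (Fin d))).restrict Ω) :=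
    isFiniteMeasure_restrict.2 hΩb.measure_lt_top.ne
  refine MemLp.of_bound ?_ ‖φ‖ (Eventually.of_forall fun x => ?_)
  · have hm : Measurable (zeroExt φ) := by
      classical
      exact Measurable.dite φ.continuous.measurable measurable_const hΩ
    exact hm.aestronglyMeasurable
  · unfold zeroExt
    split_ifs with hx
    · exact norm_zeroAtInfty_apply_le φ _
    · simp

variable (q') in
/-- The inclusion `C₀(Ω) ⊂ L^{q'}(Ω)` for a bounded domain `Ω`. -/
def c0ToLp (hΩ : MeasurableSet Ω) (hΩb : Bornology.IsBounded Ω) (φ : C₀(Ω, ℝ)) : LpOn q' Ω :=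
  (memLp_zeroExt_C0 hΩ hΩb φ).toLp (zeroExt φ)

end Convolution

end

/-! For h in L^{q'}(Ω), Fubini-free unwinding of the definition gives ∫ K(c,p) h = ∫∫ h̃(t+z) p(z)
dz dc(t), which is the pairing of c ⊗ p with the function t ↦ h̃(t+·). This function takes values in
L^{s'}(S) because s' ≤ q' and S is bounded. It is continuous because translations are continuous in
L^{s'} with s' < ∞, and by the symmetry of S it vanishes off the bounded set Ω_S. Hence it lies in
C₀(Ω_S, L^{s'}(S)).

The isometry J is onto (`injToC0_surjective`, by partitions of unity), so the function equals J ψ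
for some ψ in the predual. Agreement on simple tensors then gives K̂*h = ψ on all of X_s
(`predualToDual_eq_convLiftAdjoint`). Thus K̂* maps all of L^{q'}(Ω) into the predual, and (ii) is
the case h = φ.

For (i), every functional on L^q(Ω) is integration against some h in L^{q'}(Ω)
(`exists_integral_mul_eq_of_dual`), so its composition with K̂ is evaluation at some ψ, which is
weak* continuous. Since q ≤ 2, the representation follows from the Riesz theorem in L² and the
converse of Hölder's inequality. -/

noncomputable section

/-! ### Density of finite rank functions in `C₀(T, X)` -/

section Density

variable {T X : Type*} [TopologicalSpace T] [T2Space T] [LocallyCompactSpace T]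
  [NormedAddCommGroup X] [NormedSpace ℝ X]

/-- Functions in `C₀(T, X)` are uniform limits of finite sums `∑ φᵢ xᵢ` with `φᵢ` in `C₀(T)`. -/
theorem exists_norm_sub_sum_simpleC0_le (f : C₀(T, X)) {ε : ℝ} (hε : 0 < ε) :
    ∃ (s : Finset T) (φ : s → C₀(T, ℝ)) (x : s → X), ‖f - ∑ i, simpleC0 (φ i) (x i)‖ ≤ ε := by
  -- Off a compact set K the function is already smaller than ε, so only K needs covering.
  have hf0 : {t | ‖f t‖ < ε} ∈ cocompact T := by
    have := (zero_at_infty f).norm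
    rw [norm_zero] at this
    exact this.eventually (gt_mem_nhds hε)
  obtain ⟨K, hK, hKf⟩ := mem_cocompact.1 hf0
  have hopen : ∀ t, IsOpen (f ⁻¹' Metric.ball (f t) ε) := fun t =>
    Metric.isOpen_ball.preimage f.continuous
  obtain ⟨s, -, hs⟩ := hK.elim_nhds_subcover (fun t => f ⁻¹' Metric.ball (f t) ε)
    fun t _ => (hopen t).mem_nhds (Metric.mem_ball_self hε)
  -- The members of the partition have compact support, hence lie in C₀(T). They sum to 1 on K and
  -- to at most 1 elsewhere.
  obtain ⟨ρ, hρ, hρc⟩ := PartitionOfUnity.exists_isSubordinate_of_locallyFinite_t2space hK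
    (fun i : s => f ⁻¹' Metric.ball (f i) ε) (fun i => hopen i) (locallyFinite_of_finite _)
    (by simpa [iUnion_subtype] using hs)
  refine ⟨s, fun i => ⟨ρ i, (hρc i).is_zero_at_infty⟩, fun i => f i,
    norm_zeroAtInfty_le _ _ hε.le fun t => ?_⟩
  have hsum : ∑ i, ρ i t ≤ 1 := by
    rw [← finsum_eq_sum_of_fintype]
    exact ρ.sum_le_one t
  -- The weights 1 - ∑ ρᵢ and ρᵢ sum to 1. The first term vanishes on K and involves only values of
  -- norm below ε off K; in the others f is within ε of f(tᵢ) wherever ρᵢ ≠ 0. The total error is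
  -- therefore at most ε.
  have hval : (f - ∑ i : s, simpleC0 (⟨ρ i, (hρc i).is_zero_at_infty⟩ : C₀(T, ℝ)) (f i)) t
      = (1 - ∑ i, ρ i t) • f t + ∑ i, ρ i t • (f t - f i) := by
    have h1 : (∑ i : s, simpleC0 (⟨ρ i, (hρc i).is_zero_at_infty⟩ : C₀(T, ℝ)) (f i)) t
        = ∑ i : s, ρ i t • f i := by
      let e : C₀(T, X) →+ X :=
        { toFun := fun g => g t, map_zero' := rfl, map_add' := fun _ _ => rfl }
      exact map_sum e _ _
    rw [ZeroAtInftyContinuousMap.sub_apply, h1]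
    simp only [smul_sub, Finset.sum_sub_distrib, sub_smul, one_smul, Finset.sum_smul]
    abel
  have hout : ‖(1 - ∑ i, ρ i t) • f t‖ ≤ (1 - ∑ i, ρ i t) * ε := by
    rw [norm_smul, Real.norm_of_nonneg (sub_nonneg.2 hsum)]
    by_cases ht : t ∈ K
    · rw [← finsum_eq_sum_of_fintype, ρ.sum_eq_one ht]
      simp
    · have : ‖f t‖ < ε := hKf ht
      exact mul_le_mul_of_nonneg_left this.le (sub_nonneg.2 hsum)
  have hin : ‖∑ i, ρ i t • (f t - f i)‖ ≤ ∑ i, ρ i t * ε := by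
    refine (norm_sum_le _ _).trans (Finset.sum_le_sum fun i _ => ?_)
    rw [norm_smul, Real.norm_of_nonneg (ρ.nonneg i t)]
    by_cases ht : t ∈ tsupport (ρ i)
    · have : dist (f t) (f i) < ε := hρ i ht
      rw [dist_eq_norm] at this
      exact mul_le_mul_of_nonneg_left this.le (ρ.nonneg i t)
    · rw [image_eq_zero_of_notMem_tsupport ht]
      simp
  rw [hval]
  refine (norm_add_le _ _).trans ((add_le_add hout hin).trans (le_of_eq ?_))
  rw [← Finset.sum_mul]
  ring

/-- The canonical isometry `C₀(T) ⊗ᵢ X → C₀(T, X)` is onto. -/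
theorem injToC0_surjective [CompleteSpace X] : Function.Surjective (injToC0 T X) := by
  -- An isometric image of a complete space is closed, so a dense range suffices.
  have hclosed : IsClosed (range (injToC0 T X)) :=
    (injToC0 T X).isometry.isClosedEmbedding.isClosed_range
  have hdense : DenseRange (injToC0 T X) := fun f => by
    refine Metric.mem_closure_iff.2 fun ε hε => ?_
    obtain ⟨s, φ, x, h⟩ := exists_norm_sub_sum_simpleC0_le f (half_pos hε)
    refine ⟨_, ⟨∑ i, InjTensor.tmul (φ i) (x i), rfl⟩, ?_⟩
    have : injToC0 T X (∑ i, InjTensor.tmul (φ i) (x i)) = ∑ i, simpleC0 (φ i) (x i) := by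
      rw [map_sum]
      exact Finset.sum_congr rfl fun i _ => by
        ext t
        exact injToC0_tmul T X (φ i) (x i) t
    rw [dist_eq_norm, this]
    exact h.trans_lt (half_lt_self hε)
  exact range_eq_univ.1 (hclosed.closure_eq.symm.trans hdense.closure_range)

end Density

/-! ### The dual of `L^q` of a finite measure for `1 < q ≤ 2` -/

section LpDual

variable {α : Type*} [MeasurableSpace α] {μ : Measure α}

theorem memLp_of_measurable_of_abs_le [IsFiniteMeasure μ] {f : α → ℝ} (hf : Measurable f) {C : ℝ}
    (hC : ∀ x, |f x| ≤ C) (p : ℝ≥0∞) : MemLp f p μ :=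
  MemLp.of_bound hf.aestronglyMeasurable C (Eventually.of_forall hC)

/-- A bounded function that satisfies the duality inequality against its own extremal function
`G |G| ^ (q' - 2)` has `L^{q'}` norm at most the constant of that inequality. -/
theorem eLpNorm_le_of_extremal [IsFiniteMeasure μ] {q r : ℝ≥0∞} [ENNReal.HolderConjugate q r]
    (hq : q ≠ ∞) (hr : r ≠ ∞) (hr2 : 2 ≤ r) {G : α → ℝ} (hG : Measurable G) {M : ℝ}
    (hM : ∀ x, |G x| ≤ M) {C : ℝ}
    (h : |∫ x, (G x * |G x| ^ (r.toReal - 2)) * G x ∂μ|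
      ≤ C * (eLpNorm (fun x => G x * |G x| ^ (r.toReal - 2)) q μ).toReal) :
    eLpNorm G r μ ≤ ENNReal.ofReal C := by
  have hconj : q.toReal.HolderConjugate r.toReal :=
    ENNReal.HolderConjugate.toReal_of_ne_top hq hr
  have hr2' : 2 ≤ r.toReal := by
    simpa using ENNReal.toReal_mono hr hr2
  have hq0 : q ≠ 0 := ENNReal.HolderConjugate.ne_zero q r
  have hr0 : r ≠ 0 := ENNReal.HolderConjugate.ne_zero r q
  -- For F = G|G|^(r-2) one has |F|^q = |G|^r, since (r-1)q = r, and FG = |G|^r. With I = ∫|G|^r the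
  -- hypothesis becomes I ≤ C I^(1/q), and dividing by I^(1/q) leaves I^(1/r) ≤ C.
  have hF : ∀ x, |G x * |G x| ^ (r.toReal - 2)| = |G x| ^ (r.toReal - 1) := fun x => by
    rw [abs_mul, abs_of_nonneg (Real.rpow_nonneg (abs_nonneg _) _)]
    rcases eq_or_ne (G x) 0 with hx | hx
    · rw [hx, abs_zero, zero_mul, Real.zero_rpow (by linarith)]
    · rw [mul_comm, ← Real.rpow_add_one (abs_ne_zero.2 hx)]
      congr 1
      ring
  have hFG : ∀ x, (G x * |G x| ^ (r.toReal - 2)) * G x = |G x| ^ r.toReal := fun x => by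
    rcases eq_or_ne (G x) 0 with hx | hx
    · rw [hx, mul_zero, abs_zero, Real.zero_rpow (by linarith)]
    · have : (G x * |G x| ^ (r.toReal - 2)) * G x = |G x| ^ (r.toReal - 2) * (|G x| * |G x|) := by
        rw [abs_mul_abs_self]
        ring
      rw [this, ← mul_assoc, ← Real.rpow_add_one (abs_ne_zero.2 hx),
        ← Real.rpow_add_one (abs_ne_zero.2 hx)]
      congr 1
      ring
  have hFm : MemLp (fun x => G x * |G x| ^ (r.toReal - 2)) q μ := by
    refine memLp_of_measurable_of_abs_le (C := M ^ (r.toReal - 1)) (by fun_prop) (fun x => ?_) q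
    rw [hF]
    exact Real.rpow_le_rpow (abs_nonneg _) (hM x) (by linarith)
  set I := ∫ x, |G x| ^ r.toReal ∂μ with hI
  have hI0 : 0 ≤ I := integral_nonneg fun x => Real.rpow_nonneg (abs_nonneg _) _
  have hFn : (eLpNorm (fun x => G x * |G x| ^ (r.toReal - 2)) q μ).toReal
      = I ^ q.toReal⁻¹ := by
    rw [hFm.eLpNorm_eq_integral_rpow_norm hq0 hq, ENNReal.toReal_ofReal (by positivity)]
    congr 1
    refine integral_congr_ae (Eventually.of_forall fun x => ?_)
    simp only [Real.norm_eq_abs]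
    rw [hF, ← Real.rpow_mul (abs_nonneg _)]
    congr 1
    exact hconj.symm.sub_one_mul_conj
  simp only [hFG] at h
  rw [hFn, ← hI, abs_of_nonneg hI0] at h
  rw [(memLp_of_measurable_of_abs_le hG hM r).eLpNorm_eq_integral_rpow_norm hr0 hr]
  refine ENNReal.ofReal_le_ofReal_iff'.2 ?_
  simp only [Real.norm_eq_abs]
  rw [← hI]
  -- If I = 0, no sign of C is known; the left side is then 0, which suffices after
  -- `ENNReal.ofReal`.
  rcases hI0.eq_or_lt with h0 | h0
  · right
    rw [← h0, Real.zero_rpow (inv_ne_zero (by linarith))]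
  · left
    have hpow : I = I ^ r.toReal⁻¹ * I ^ q.toReal⁻¹ := by
      rw [← Real.rpow_add h0, hconj.symm.inv_add_inv_eq_one, Real.rpow_one]
    have hpos : 0 < I ^ q.toReal⁻¹ := Real.rpow_pos_of_pos h0 _
    refine le_of_mul_le_mul_right ?_ hpos
    rwa [← hpow]

/-- The converse of Hölder's inequality for a finite measure. -/
theorem memLp_of_abs_integral_mul_le [IsFiniteMeasure μ] {q r : ℝ≥0∞}
    [ENNReal.HolderConjugate q r] (hq : q ≠ ∞) (hr : r ≠ ∞) (hr2 : 2 ≤ r) {g : α → ℝ}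
    (hg : Measurable g) {C : ℝ}
    (h : ∀ f : α → ℝ, Measurable f → (∃ M, ∀ x, |f x| ≤ M) →
      |∫ x, f x * g x ∂μ| ≤ C * (eLpNorm f q μ).toReal) : MemLp g r μ := by
  have hr2' : 2 ≤ r.toReal := by
    simpa using ENNReal.toReal_mono hr hr2
  -- The truncations are bounded, so their extremal functions are admissible tests. They give a
  -- bound on the L^r norm of `G n` uniform in n, which passes to the limit g by Fatou's lemma.
  let G : ℕ → α → ℝ := fun n => {x | |g x| ≤ n}.indicator g
  have hGm : ∀ n, Measurable (G n) := fun n =>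
    hg.indicator (measurableSet_le (by fun_prop) measurable_const)
  have hGb : ∀ n x, |G n x| ≤ n := fun n x => by
    by_cases hx : |g x| ≤ n
    · simp [G, hx]
    · simp [G, hx]
  have hGn : ∀ n, eLpNorm (G n) r μ ≤ ENNReal.ofReal C := fun n => by
    refine eLpNorm_le_of_extremal hq hr hr2 (hGm n) (hGb n) ?_
    -- The extremal function vanishes where g is cut off, so it pairs equally with `G n` and with g.
    have hGg : ∀ x, (G n x * |G n x| ^ (r.toReal - 2)) * G n x
        = (G n x * |G n x| ^ (r.toReal - 2)) * g x := fun x => by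
      by_cases hx : |g x| ≤ n
      · simp [G, hx]
      · simp [G, hx]
    simp only [hGg]
    have hm := hGm n
    -- Monotonicity of t ↦ t^(r-2) requires r ≥ 2, that is, q ≤ 2.
    refine h _ (by fun_prop) ⟨(n : ℝ) * (n : ℝ) ^ (r.toReal - 2), fun x => ?_⟩
    rw [abs_mul, abs_of_nonneg (Real.rpow_nonneg (abs_nonneg _) _)]
    exact mul_le_mul (hGb n x) (Real.rpow_le_rpow (abs_nonneg _) (hGb n x) (by linarith))
      (Real.rpow_nonneg (abs_nonneg _) _) (Nat.cast_nonneg n)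
  refine ⟨hg.aestronglyMeasurable, lt_of_le_of_lt ?_ (ENNReal.ofReal_lt_top (r := C))⟩
  refine Lp.eLpNorm_le_of_ae_tendsto (u := atTop) (f := G) (Eventually.of_forall hGn)
    (fun n => (hGm n).aestronglyMeasurable) (Eventually.of_forall fun x => ?_)
  refine tendsto_const_nhds.congr' ?_
  filter_upwards [eventually_ge_atTop ⌈|g x|⌉₊] with n hn
  have : |g x| ≤ n := (Nat.le_ceil _).trans (Nat.cast_le.2 hn)
  simp [G, this]

/-- The inclusion of `L^s` into `L^q` for a finite measure and `q ≤ s`. -/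
def lpInclusion [IsFiniteMeasure μ] {q s : ℝ≥0∞} [Fact (1 ≤ q)] [Fact (1 ≤ s)] (hqs : q ≤ s) :
    Lp ℝ s μ →L[ℝ] Lp ℝ q μ :=
  LinearMap.mkContinuous
    { toFun := fun f => ((Lp.memLp f).mono_exponent hqs).toLp f
      map_add' := fun f g => by
        rw [← MemLp.toLp_add]
        exact MemLp.toLp_congr _ _ (Lp.coeFn_add f g)
      map_smul' := fun a f => by
        rw [RingHom.id_apply, ← MemLp.toLp_const_smul]
        exact MemLp.toLp_congr _ _ (Lp.coeFn_smul a f) }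
    (μ univ ^ (1 / q.toReal - 1 / s.toReal)).toReal (fun f => by
      have hfin : μ univ ^ (1 / q.toReal - 1 / s.toReal) ≠ ∞ := by
        refine ENNReal.rpow_ne_top_of_nonneg ?_ (measure_ne_top _ _)
        rcases eq_or_ne s ∞ with rfl | hs
        · simp
        · have hq1 : (1 : ℝ) ≤ q.toReal := by
            simpa using ENNReal.toReal_mono (ne_top_of_le_ne_top hs hqs) (Fact.out : 1 ≤ q)
          exact sub_nonneg.2 (one_div_le_one_div_of_le (by linarith) (ENNReal.toReal_mono hs hqs))
      change ‖((Lp.memLp f).mono_exponent hqs).toLp f‖ ≤ _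
      rw [Lp.norm_toLp, Lp.norm_def, ← ENNReal.toReal_mul]
      refine ENNReal.toReal_mono (ENNReal.mul_ne_top hfin (Lp.eLpNorm_ne_top f)) ?_
      rw [mul_comm]
      exact eLpNorm_le_eLpNorm_mul_rpow_measure_univ hqs (Lp.aestronglyMeasurable f))

theorem lpInclusion_toLp [IsFiniteMeasure μ] {q s : ℝ≥0∞} [Fact (1 ≤ q)] [Fact (1 ≤ s)]
    (hqs : q ≤ s) {f : α → ℝ} (hf : MemLp f s μ) :
    lpInclusion hqs (hf.toLp f) = (hf.mono_exponent hqs).toLp f :=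
  MemLp.toLp_congr ((Lp.memLp (hf.toLp f)).mono_exponent hqs) _ hf.coeFn_toLp

/-- Every bounded functional on `L^q` of a finite measure is represented by a function in
`L^{q'}`, if `1 < q ≤ 2`. -/
theorem exists_integral_mul_eq_of_dual [IsFiniteMeasure μ] {q r : ℝ≥0∞} [Fact (1 ≤ q)]
    [Fact (1 ≤ r)] [ENNReal.HolderConjugate q r] (hr : r ≠ ∞) (hq2 : q ≤ 2)
    (Λ : StrongDual ℝ (Lp ℝ q μ)) : ∃ h : Lp ℝ r μ, ∀ f : Lp ℝ q μ, Λ f = ∫ x, f x * h x ∂μ := by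
  have hq : q ≠ ∞ := ne_top_of_le_ne_top (by simp) hq2
  have hr2 : 2 ≤ r := by
    have h1 := ENNReal.HolderConjugate.inv_add_inv_eq_one q r
    have h2 : (2 : ℝ≥0∞)⁻¹ ≤ q⁻¹ := ENNReal.inv_le_inv.2 hq2
    refine ENNReal.inv_le_inv.1 ?_
    by_contra! h3
    have h4 := ENNReal.add_lt_add_of_le_of_lt (by simp) h2 h3
    rw [h1, ENNReal.inv_two_add_inv_two] at h4
    exact lt_irrefl _ h4
  -- Since μ is finite and q ≤ 2, L² embeds into L^q. The functional thus restricts to L², where the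
  -- Riesz theorem represents it.
  let u : Lp ℝ 2 μ := (InnerProductSpace.toDual ℝ (Lp ℝ 2 μ)).symm (Λ.comp (lpInclusion hq2))
  have hu : ∀ f : Lp ℝ 2 μ, Λ (lpInclusion hq2 f) = ∫ x, f x * u x ∂μ := fun f => by
    have h1 : inner ℝ u f = Λ (lpInclusion hq2 f) :=
      InnerProductSpace.toDual_symm_apply
    rw [← h1, L2.inner_def]
    simp
  obtain ⟨g, hg, hug⟩ := (Lp.aestronglyMeasurable u).aemeasurable
  have hrep : ∀ {f : α → ℝ} (hf : MemLp f 2 μ),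
      Λ ((hf.mono_exponent hq2).toLp f) = ∫ x, f x * g x ∂μ := fun {f} hf => by
    rw [← lpInclusion_toLp hq2 hf, hu]
    refine integral_congr_ae ?_
    filter_upwards [hf.coeFn_toLp, hug] with x h1 h2
    rw [h1, h2]
  -- Bounded functions lie in L², so testing with them bounds ∫ f g by ‖Λ‖ times the L^q norm of f,
  -- which improves g from L² to L^r.
  have hgr : MemLp g r μ := by
    refine memLp_of_abs_integral_mul_le (q := q) (C := ‖Λ‖) hq hr hr2 hg fun f hf ⟨M, hM⟩ => ?_
    rw [← hrep (memLp_of_measurable_of_abs_le hf hM 2), ← Real.norm_eq_abs, ← Lp.norm_toLp]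
    exact Λ.le_opNorm _
  refine ⟨hgr.toLp g, fun f => ?_⟩
  let P : StrongDual ℝ (Lp ℝ q μ) :=
    ((ContinuousLinearMap.mul ℝ ℝ).lpPairing μ q r).flip (hgr.toLp g)
  have hP : ∀ f, P f = ∫ x, f x * hgr.toLp g x ∂μ := fun f =>
    ContinuousLinearMap.lpPairing_eq_integral _ f _
  rw [← hP]
  -- Both functionals are continuous on L^q, q < ∞, so agreement on indicators of sets of finite
  -- measure is enough.
  refine Lp.induction hq (fun f => Λ f = P f) ?_ ?_ (isClosed_eq Λ.continuous P.continuous) f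
  · intro c s hs hμs
    have hm : MemLp (s.indicator fun _ => c) 2 μ := memLp_indicator_const 2 hs c (Or.inr hμs.ne)
    refine (hrep hm).trans ((integral_congr_ae ?_).trans (hP _).symm)
    filter_upwards [hgr.coeFn_toLp, (hm.mono_exponent hq2).coeFn_toLp] with x h1 h2
    rw [h1]
    congr 1
    exact h2.symm
  · intro f f' hf hf' _ h1 h2
    rw [map_add, map_add, h1, h2]

end LpDual

/-! ### Functionals on tensor products -/

section Functionals

/-- Bounded linear maps on the projective tensor product are determined by simple tensors. -/
theorem ProjTensor.clm_ext {X Y Z : Type*} [NormedAddCommGroup X] [NormedSpace ℝ X]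
    [NormedAddCommGroup Y] [NormedSpace ℝ Y] [NormedAddCommGroup Z] [NormedSpace ℝ Z]
    {L L' : ProjTensor X Y →L[ℝ] Z}
    (h : ∀ x y, L (ProjTensor.tmul x y) = L' (ProjTensor.tmul x y)) : L = L' := by
  ext u
  refine UniformSpace.Completion.induction_on u (isClosed_eq L.continuous L'.continuous)
    fun v => ?_
  refine TensorProduct.induction_on (R := ℝ) (M := X) (N := Y)
    (motive := fun v => L ((show ProjAlg X Y from v : ProjAlg X Y) : ProjTensor X Y)
      = L' ((show ProjAlg X Y from v : ProjAlg X Y) : ProjTensor X Y)) v ?_ h ?_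
  · exact (congrArg L UniformSpace.Completion.coe_zero).trans ((map_zero L).trans
      ((map_zero L').symm.trans (congrArg L' UniformSpace.Completion.coe_zero.symm)))
  · intro v w hv hw
    have hadd := UniformSpace.Completion.coe_add (show ProjAlg X Y from v)
      (show ProjAlg X Y from w)
    refine (congrArg L hadd).trans (Eq.trans ?_ (congrArg L' hadd).symm)
    rw [map_add, map_add, hv, hw]

/-- Supplies the continuity needed to carry identities from algebraic tensors to the completion. -/
theorem continuous_compC0 {T X Y : Type*} [TopologicalSpace T] [NormedAddCommGroup X]
    [NormedSpace ℝ X] [NormedAddCommGroup Y] [NormedSpace ℝ Y] (L : X →L[ℝ] Y) :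
    Continuous (compC0 L : C₀(T, X) → C₀(T, Y)) := by
  refine (LipschitzWith.of_dist_le_mul (K := ‖L‖₊) fun f g => ?_).continuous
  rw [dist_eq_norm, dist_eq_norm]
  refine norm_zeroAtInfty_le _ _ (by positivity) fun t => ?_
  have h : (compC0 L f - compC0 L g) t = L ((f - g) t) := (map_sub L _ _).symm
  rw [h]
  refine (L.le_opNorm _).trans ?_
  rw [coe_nnnorm]
  gcongr
  exact norm_zeroAtInfty_apply_le _ t

/-- The bilinear form of an element `u` of `C₀(T) ⊗ᵢ X` is `(φ, ψ) ↦ φ(ψ ∘ J u)`. -/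
theorem InjTensor.toBilin_eq_compC0 {T X : Type*} [TopologicalSpace T] [NormedAddCommGroup X]
    [NormedSpace ℝ X] [CompleteSpace X] (u : InjTensor C₀(T, ℝ) X)
    (φ : StrongDual ℝ C₀(T, ℝ)) (ψ : StrongDual ℝ X) :
    InjTensor.toBilin C₀(T, ℝ) X u φ ψ = φ (compC0 ψ (injToC0 T X u)) := by
  refine UniformSpace.Completion.induction_on u (isClosed_eq ?_ ?_) fun v => ?_
  · fun_prop
  · exact φ.continuous.comp ((continuous_compC0 ψ).comp (injToC0 T X).continuous)
  · have h1 := ContinuousLinearMap.extend_eq (injBilinL C₀(T, ℝ) X)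
      (e := (UniformSpace.Completion.toComplL :
        InjAlg C₀(T, ℝ) X →L[ℝ] InjTensor C₀(T, ℝ) X))
      UniformSpace.Completion.denseRange_coe (UniformSpace.Completion.isUniformInducing_coe _) v
    have h2 := ContinuousLinearMap.extend_eq (injToC0AlgL T X)
      (e := (UniformSpace.Completion.toComplL :
        InjAlg C₀(T, ℝ) X →L[ℝ] InjTensor C₀(T, ℝ) X))
      UniformSpace.Completion.denseRange_coe (UniformSpace.Completion.isUniformInducing_coe _) v
    refine (congrArg (fun b => b φ ψ) h1).trans ((injBilin_apply_eq T X v φ ψ).trans ?_)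
    exact congrArg (fun f => φ (compC0 ψ f)) h2.symm

end Functionals

/-! ### The preadjoint of the lifted convolution operator -/

section Preadjoint

variable {d : ℕ} {Ω S : Set (EuclideanSpace ℝ (Fin d))} {q s q' s' : ℝ≥0∞}

theorem isOpen_extDomain (hΩ : IsOpen Ω) : IsOpen (extDomain Ω S) := by
  have : extDomain Ω S = ⋃ y ∈ S, (fun x => x - y) ⁻¹' Ω := by
    ext x
    simp [extDomain]
  rw [this]
  exact isOpen_biUnion fun y _ => hΩ.preimage (by fun_prop)

theorem isBounded_extDomain (hΩ : Bornology.IsBounded Ω) (hS : Bornology.IsBounded S) :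
    Bornology.IsBounded (extDomain Ω S) := by
  refine (hΩ.add hS).subset ?_
  rintro x ⟨y, hy, hx⟩
  exact ⟨x - y, hx, y, hy, sub_add_cancel x y⟩

/-- A continuous function on a proper space that vanishes off a bounded set `U` restricts to a
function on `U` that vanishes at infinity. -/
def restrictC0 {E F : Type*} [PseudoMetricSpace E] [ProperSpace E] [NormedAddCommGroup F]
    {U : Set E} (hU : Bornology.IsBounded U) {f : E → F} (hf : Continuous f)
    (h0 : ∀ x ∉ U, f x = 0) : C₀(U, F) where
  toFun t := f t
  continuous_toFun := hf.comp continuous_subtype_val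
  zero_at_infty' := by
    rw [tendsto_zero_iff_norm_tendsto_zero, Metric.tendsto_nhds]
    intro ε hε
    -- Superlevel sets are closed in the ambient proper space and bounded, hence compact. As they
    -- lie inside U, they remain compact in the subspace.
    have hsub : {x | ε ≤ ‖f x‖} ⊆ U := fun x hx => by
      by_contra hxU
      have hx' : ε ≤ ‖f x‖ := hx
      rw [h0 x hxU, norm_zero] at hx'
      exact hε.not_ge hx'
    have hK : IsCompact {x | ε ≤ ‖f x‖} :=
      Metric.isCompact_of_isClosed_isBounded (isClosed_le continuous_const hf.norm)
        (hU.subset hsub)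
    have hK' : IsCompact ((↑) ⁻¹' {x | ε ≤ ‖f x‖} : Set U) := by
      rw [Subtype.isCompact_iff, Subtype.image_preimage_coe, inter_eq_right.2 hsub]
      exact hK
    filter_upwards [hK'.compl_mem_cocompact] with t ht
    simpa using ht

/-- Reconciles two zero extensions: that of the L^{q'} class used by K̂*, and the pointwise one of
φ. -/
theorem indicator_c0ToLp_ae (hΩ : MeasurableSet Ω) (hΩb : Bornology.IsBounded Ω) (φ : C₀(Ω, ℝ)) :
    Ω.indicator (c0ToLp q' hΩ hΩb φ) =ᵐ[volume] zeroExt φ := by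
  have h1 : Ω.indicator (zeroExt φ) = zeroExt φ :=
    indicator_eq_self.2 fun x hx => by
      by_contra hxΩ
      exact hx (dif_neg hxΩ)
  rw [← h1]
  exact (ae_eq_restrict_iff_indicator_ae_eq hΩ).1 (MemLp.coeFn_toLp (memLp_zeroExt_C0 hΩ hΩb φ))

variable [Fact (1 ≤ q)] [Fact (1 ≤ s)] [Fact (1 ≤ q')] [Fact (1 ≤ s')]

/-- If x ∈ S and x + t ∈ Ω, then t - (-x) ∈ Ω with -x ∈ S, so t ∈ Ω_S. This is where the symmetry of
S enters. -/
theorem placedAtom_eq_zero (hΩ : MeasurableSet Ω) (hΩb : Bornology.IsBounded Ω) (hs' : s' ≤ q')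
    (hS : MeasurableSet S) (hSsymm : ∀ x ∈ S, -x ∈ S) (h : LpOn q' Ω)
    {t : EuclideanSpace ℝ (Fin d)} (ht : t ∉ extDomain Ω S) :
    placedAtom S hΩ hΩb hs' (-t) h = 0 := by
  rw [Lp.eq_zero_iff_ae_eq_zero]
  filter_upwards [placedAtom_ae S hΩ hΩb hs' (-t) h, ae_restrict_mem hS] with x hx hxS
  rw [hx, indicator_of_notMem, Pi.zero_apply]
  intro hxt
  refine ht ⟨-x, hSsymm x hxS, ?_⟩
  convert hxt using 1
  abel

/-- The function `t ↦ h̃(t + ·)` in `C₀(Ω_S, L^{s'}(S))` for `h` in `L^{q'}(Ω)`. -/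
def translatesC0 (hΩ : MeasurableSet Ω) (hΩb : Bornology.IsBounded Ω) (hs' : s' ≤ q')
    (hs'top : s' ≠ ∞) (hS : MeasurableSet S) (hSb : Bornology.IsBounded S)
    (hSsymm : ∀ x ∈ S, -x ∈ S) (h : LpOn q' Ω) : C₀(extDomain Ω S, LpOn s' S) :=
  -- The roles of Ω and S are exchanged: h is the atom, living on Ω, placed at -t and restricted to
  -- S.
  restrictC0 (isBounded_extDomain hΩb hSb)
    (f := fun t => placedAtom S hΩ hΩb hs' (-t) h)
    ((continuous_placedAtom S hΩ hΩb hs' hs'top h).comp continuous_neg)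
    fun _ ht => placedAtom_eq_zero hΩ hΩb hs' hS hSsymm h ht

theorem translatesC0_ae (hΩ : MeasurableSet Ω) (hΩb : Bornology.IsBounded Ω) (hs' : s' ≤ q')
    (hs'top : s' ≠ ∞) (hS : MeasurableSet S) (hSb : Bornology.IsBounded S)
    (hSsymm : ∀ x ∈ S, -x ∈ S) (h : LpOn q' Ω) (t : extDomain Ω S) :
    translatesC0 hΩ hΩb hs' hs'top hS hSb hSsymm h t =ᵐ[volume.restrict S]
      fun x => Ω.indicator h (x + (t : EuclideanSpace ℝ (Fin d))) := by
  filter_upwards [placedAtom_ae S hΩ hΩb hs' (-(t : EuclideanSpace ℝ (Fin d))) h] with x hx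
  rw [sub_neg_eq_add] at hx
  exact hx

/-- Makes the pairing concrete for every ψ, including those that are only limits of finite tensors.
-/
theorem liftPairing_tmul_eq_integral [ENNReal.HolderConjugate s s']
    (c : RadonMeasure (extDomain Ω S)) (p : LpOn s S) (ψ : PredualSpace Ω S s') :
    liftPairing Ω S s s' (ProjTensor.tmul c p) ψ
      = c.integral fun t => ∫ x in S, p x * injToC0 (extDomain Ω S) (LpOn s' S) ψ t x := by
  unfold liftPairing
  rw [ProjTensor.lift_tmul]
  refine (dualTensor_apply _ _ _).trans ((InjTensor.toBilin_eq_compC0 _ _ _).trans ?_)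
  refine (RadonMeasure.toDual_apply c _).trans ?_
  exact congrArg c.integral (funext fun t => lpDual_apply S s s' p _)

/-- `K̂* h` is given by `t ↦ h̃(t + ·)`, seen as an element of `C₀(Ω_S) ⊗ᵢ L^{s'}(S)`. -/
theorem predualToDual_eq_convLiftAdjoint [ENNReal.HolderConjugate q q']
    [ENNReal.HolderConjugate s s'] (hΩ : MeasurableSet Ω) (hΩb : Bornology.IsBounded Ω)
    (hs' : s' ≤ q') (hs'top : s' ≠ ∞) (hS : MeasurableSet S) (hSb : Bornology.IsBounded S)
    (hSsymm : ∀ x ∈ S, -x ∈ S) (hqs : q ≤ s) (hq : q ≠ ∞) (h : LpOn q' Ω)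
    (ψ : PredualSpace Ω S s')
    (hψ : injToC0 (extDomain Ω S) (LpOn s' S) ψ
      = translatesC0 hΩ hΩb hs' hs'top hS hSb hSsymm h) :
    predualToDual Ω S s s' ψ = convLiftAdjoint Ω q' hS hSb hqs hq h := by
  refine ProjTensor.clm_ext fun c p => ?_
  rw [convLiftAdjoint_apply, convLift, ProjTensor.lift_tmul, integral_convBilin_mul Ω hΩ hS hSb]
  refine (liftPairing_tmul_eq_integral c p ψ).trans (congrArg c.integral (funext fun t => ?_))
  rw [hψ]
  -- The cut-off of p becomes a restriction of the domain to S, where J ψ(t) is known almost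
  -- everywhere.
  have h1 : ∀ z, Ω.indicator h (z + (t : EuclideanSpace ℝ (Fin d))) * S.indicator p z
      = S.indicator (fun z => p z * Ω.indicator h (z + (t : EuclideanSpace ℝ (Fin d)))) z :=
    fun z => by by_cases hz : z ∈ S <;> simp [hz, mul_comm]
  simp only [h1]
  rw [integral_indicator hS]
  refine integral_congr_ae ?_
  filter_upwards [translatesC0_ae hΩ hΩb hs' hs'top hS hSb hSsymm h t] with x hx
  rw [hx]

/-- Arbitrary h in L^{q'}(Ω) is allowed, because the weak topology of L^q(Ω) is tested by its whole
dual and not only by C₀(Ω). -/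
theorem exists_predualToDual_eq_convLiftAdjoint [ENNReal.HolderConjugate q q']
    [ENNReal.HolderConjugate s s'] (hΩ : IsOpen Ω) (hΩb : Bornology.IsBounded Ω)
    (hs' : s' ≤ q') (hs'top : s' ≠ ∞) (hS : MeasurableSet S) (hSb : Bornology.IsBounded S)
    (hSsymm : ∀ x ∈ S, -x ∈ S) (hqs : q ≤ s) (hq : q ≠ ∞) (h : LpOn q' Ω) :
    ∃ ψ : PredualSpace Ω S s',
      predualToDual Ω S s s' ψ = convLiftAdjoint Ω q' hS hSb hqs hq h ∧
      ∀ t : extDomain Ω S, injToC0 (extDomain Ω S) (LpOn s' S) ψ t =ᵐ[volume.restrict S]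
        fun x => Ω.indicator h (x + (t : EuclideanSpace ℝ (Fin d))) := by
  have : LocallyCompactSpace (extDomain Ω S) := (isOpen_extDomain hΩ).locallyCompactSpace
  obtain ⟨ψ, hψ⟩ := injToC0_surjective
    (translatesC0 hΩ.measurableSet hΩb hs' hs'top hS hSb hSsymm h)
  refine ⟨ψ, predualToDual_eq_convLiftAdjoint hΩ.measurableSet hΩb hs' hs'top hS hSb hSsymm hqs
    hq h ψ hψ, fun t => ?_⟩
  rw [hψ]
  exact translatesC0_ae hΩ.measurableSet hΩb hs' hs'top hS hSb hSsymm h t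

end Preadjoint

end

theorem mainTheorem6 {d : ℕ} (Ω S : Set (EuclideanSpace ℝ (Fin d)))
    (hΩ : IsOpen Ω) (hΩb : Bornology.IsBounded Ω)
    (hS : IsOpen S) (hSb : Bornology.IsBounded S) (hSsymm : ∀ x ∈ S, -x ∈ S)
    (q s q' s' : ℝ≥0∞) [Fact (1 ≤ q)] [Fact (1 ≤ s)] [Fact (1 ≤ q')] [Fact (1 ≤ s')]
    [ENNReal.HolderConjugate q q'] [ENNReal.HolderConjugate s s']
    (hq1 : 1 < q) (hq2 : q ≤ 2) (hqs : q ≤ s) (hs : s ≠ ∞) :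
    Continuous (fun u : LiftSpaceWeakStar Ω S s s' =>
      toWeakSpace ℝ (LpOn q Ω)
        (convLift Ω hS.measurableSet hSb hqs (ne_top_of_le_ne_top hs hqs) u)) ∧
    ∀ φ : C₀(Ω, ℝ), ∃ ψ : PredualSpace Ω S s',
      predualToDual Ω S s s' ψ =
        convLiftAdjoint Ω q' hS.measurableSet hSb hqs (ne_top_of_le_ne_top hs hqs)
          (c0ToLp q' hΩ.measurableSet hΩb φ) ∧
      ∀ t : extDomain Ω S,
        injToC0 (extDomain Ω S) (LpOn s' S) ψ t =ᵐ[volume.restrict S]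
          fun x => zeroExt φ ((t : EuclideanSpace ℝ (Fin d)) + x) := by
  have hq := ne_top_of_le_ne_top hs hqs
  -- Conjugation reverses the order of exponents: 1/r' = 1 - 1/r.
  have hs'q' : s' ≤ q' := by
    rw [← ENNReal.inv_le_inv, ← ENNReal.HolderConjugate.one_sub_inv q q',
      ← ENNReal.HolderConjugate.one_sub_inv s s']
    exact tsub_le_tsub_left (ENNReal.inv_le_inv.2 hqs) 1
  have hs' : s' ≠ ∞ :=
    (ENNReal.HolderConjugate.lt_top_iff_one_lt s' s).2 (hq1.trans_le hqs) |>.ne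
  have hq' : q' ≠ ∞ := (ENNReal.HolderConjugate.lt_top_iff_one_lt q' q).2 hq1 |>.ne
  have key := exists_predualToDual_eq_convLiftAdjoint hΩ hΩb hs'q' hs' hS.measurableSet hSb hSsymm
    hqs hq
  refine ⟨?_, fun φ => ?_⟩
  · refine WeakBilin.continuous_of_continuous_eval _ fun Λ => ?_
    have : IsFiniteMeasure ((volume : Measure (EuclideanSpace ℝ (Fin d))).restrict Ω) :=
      isFiniteMeasure_restrict.2 hΩb.measure_lt_top.ne
    obtain ⟨h, hh⟩ := exists_integral_mul_eq_of_dual hq' hq2 Λ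
    obtain ⟨ψ, hψ, -⟩ := key h
    refine (WeakBilin.eval_continuous (liftPairing Ω S s s').toLinearMap₁₂ ψ).congr fun u => ?_
    have h1 := congrArg (fun L : StrongDual ℝ (LiftSpace Ω S s) => L u) hψ
    exact (h1.trans (convLiftAdjoint_apply Ω hS.measurableSet hSb hqs hq h u)).trans (hh _).symm
  · obtain ⟨ψ, hψ, hψt⟩ := key (c0ToLp q' hΩ.measurableSet hΩb φ)
    refine ⟨ψ, hψ, fun t => (hψt t).trans (ae_restrict_of_ae ?_)⟩
    -- The two extensions agree off a null set of ℝᵈ, and translation by t preserves null sets.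
    have := (measurePreserving_add_right volume
      (t : EuclideanSpace ℝ (Fin d))).quasiMeasurePreserving.ae_eq_comp
        (indicator_c0ToLp_ae (q' := q') hΩ.measurableSet hΩb φ)
    filter_upwards [this] with x hx
    rw [add_comm (t : EuclideanSpace ℝ (Fin d))]
    exact hx
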